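/- Equip $\mathbb R^k$ with the norm $|x|=\max_j|x_j|$. A *cone* in $\mathbb R^k$ is a nonempty set $U$ with $tx\in U$ for all $x\in U$, $t>0$. A cone $U$ is *proper* if $\bar U\setminus\{0\}\subset\{x : l(x)>0\}$ for some linear functional $l$ on $\mathbb R^k$. A *conic neighborhood* of $U$ is a cone $W\supset U$ such that $W\setminus\{0\}$ is open. For a cone $W$ and $A,B>0$, let $S^{0,B}_{1,A}(W)$ be the Banach space of entire functions $f$ on $\mathbb C^k$ with finite norm $$\sup_{z=x+iy\in\mathbb C^k}|f(z)|\exp\bigl(|x/A|-\delta_W(Bx)-|By|\bigr),\qquad \delta_W(x)=\inf_{x'\in W}|x-x'|.$$ For a closed cone $K$, let $S^0_1(K)=\bigcup_{A,B>0,\,W\supset K}S^{0,B}_{1,A}(W)$, where $W$ runs over the conic neighborhoods of $K$, with the locally convex inductive limit topology, and let $S'^{\,0}_1(K)$ be its continuous dual with the strong topology. For closed cones $K'\subset K$ let $\rho_{K',K}\colon S'^{\,0}_1(K')\to S'^{\,0}_1(K)$ be the restriction of functionals to $S^0_1(K)\subset S^0_1(K')$. For a closed cone $M\subset\mathbb R^k$,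 let $\mathcal P(M)$ be the set of all proper closed cones contained in $M$, ordered by inclusion, and let $$\mathcal U(M)=\varinjlim_{K\in\mathcal P(M)}S'^{\,0}_1(K),$$ that is, the quotient of $\bigoplus_{K\in\mathcal P(M)}S'^{\,0}_1(K)$ by the subspace spanned by the elements $\iota_{K'}u-\iota_K\rho_{K',K}u$ with $K'\subset K$ in $\mathcal P(M)$ and $u\in S'^{\,0}_1(K')$, where $\iota_K$ is the canonical embedding of $S'^{\,0}_1(K)$ in the direct sum. The inductive limit topology on $\mathcal U(M)$ is the finest locally convex topology for which all the canonical maps $S'^{\,0}_1(K)\to\mathcal U(M)$, $K\in\mathcal P(M)$, are continuous. **Lemma.** Let $M$ be a closed cone in $\mathbb R^k$ containing a straight line. Then the inductive limit topology on $\mathcal U(M)$ is trivial, i.e. $\varnothing$ and $\mathcal U(M)$ are its only open sets. -/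

import Mathlib

/-! ### Cones in `ℝ^k`

`ℝ^k` is `Fin k → ℝ` and `ℂ^k` is `Fin k → ℂ`; the norm on them is the uniform norm. -/

/-- A (nonempty) cone in `ℝ^k`: a nonempty set stable under multiplication by positive numbers. -/
def IsCone {k : ℕ} (U : Set (Fin k → ℝ)) : Prop :=
  U.Nonempty ∧ ∀ t : ℝ, 0 < t → ∀ x ∈ U, t • x ∈ U

/-- `W` is a conic neighborhood of `U`: a cone containing `U` whose projection to the sphere
`(ℝ^k ∖ {0}) / ℝ₊` is open. By definition of the quotient topology, the latter means that
`W ∖ {0}` is open. -/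
def IsConicNhd {k : ℕ} (W U : Set (Fin k → ℝ)) : Prop :=
  IsCone W ∧ U ⊆ W ∧ IsOpen (W \ {0})

/-- `U` is proper: `closure U ∖ {0}` is contained in an open half-space `{x | 0 < l x}`. -/
def IsProperCone {k : ℕ} (U : Set (Fin k → ℝ)) : Prop :=
  ∃ l : (Fin k → ℝ) →ₗ[ℝ] ℝ, ∀ x ∈ closure U, x ≠ 0 → 0 < l x

/-! ### The locally convex inductive limit topology -/

section LcFinal

variable {ι : Type*} {X : ι → Type*} [∀ i, AddCommGroup (X i)] [∀ i, Module ℂ (X i)]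
  [∀ i, TopologicalSpace (X i)] {E : Type*} [AddCommGroup E] [Module ℂ E]

/-- The set of all locally convex vector space topologies on `E` for which all the linear maps
`g i : X i → E` are continuous. -/
def lcAdmissible (g : ∀ i, X i →ₗ[ℂ] E) : Set (TopologicalSpace E) :=
  {t | @IsTopologicalAddGroup E t _ ∧ @ContinuousSMul ℂ E _ _ t ∧
    @LocallyConvexSpace ℝ E _ _ _ _ t ∧ ∀ i, @Continuous _ _ _ t (g i)}

/-- The inductive limit topology: the finest locally convex vector space topology on `E` for which
all the linear maps `g i : X i → E` are continuous (in Mathlib, `t ≤ t'` means that `t` is finer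
than `t'`). -/
@[reducible] def lcFinalTopology (g : ∀ i, X i →ₗ[ℂ] E) : TopologicalSpace E :=
  sInf (lcAdmissible g)

theorem lcFinalTopology_mem (g : ∀ i, X i →ₗ[ℂ] E) : lcFinalTopology g ∈ lcAdmissible g :=
  ⟨topologicalAddGroup_sInf fun _ ht => ht.1, continuousSMul_sInf fun _ ht => ht.2.1,
    LocallyConvexSpace.sInf fun _ ht => ht.2.2.1,
    fun i => continuous_sInf_rng.2 fun _ ht => ht.2.2.2 i⟩

/-- Universal property: a linear map out of the inductive limit into a locally convex space is
continuous as soon as its compositions with all the `g i` are. -/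
theorem lcFinalTopology_continuous (g : ∀ i, X i →ₗ[ℂ] E) {F : Type*} [AddCommGroup F]
    [Module ℂ F] [tF : TopologicalSpace F] [IsTopologicalAddGroup F] [ContinuousSMul ℂ F]
    [LocallyConvexSpace ℝ F] (h : E →ₗ[ℂ] F) (hg : ∀ i, Continuous (h ∘ g i)) :
    @Continuous _ _ (lcFinalTopology g) _ h := by
  refine continuous_iff_le_induced.2 (sInf_le ⟨topologicalAddGroup_induced h,
    continuousSMul_induced h, LocallyConvexSpace.induced (h.restrictScalars ℝ),
    fun i => continuous_induced_rng.2 (hg i)⟩)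

end LcFinal

/-! ### The Banach spaces `S^{0,B}_{1,A}(U)` -/

/-- The weight `exp (|x/A| - δ_U(Bx) - |By|)`, `z = x + iy`, where `δ_U` is the distance to `U`. -/
noncomputable def coneWeight {k : ℕ} (U : Set (Fin k → ℝ)) (A B : ℝ) (z : Fin k → ℂ) : ℝ :=
  Real.exp (‖A⁻¹ • (fun j => (z j).re)‖ - Metric.infDist (B • (fun j => (z j).re)) U
    - ‖B • (fun j => (z j).im)‖)

theorem coneWeight_pos {k : ℕ} (U : Set (Fin k → ℝ)) (A B : ℝ) (z : Fin k → ℂ) :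
    0 < coneWeight U A B z := Real.exp_pos _

/-- The entire functions `f` on `ℂ^k` for which
`sup_z |f(z)| exp (|x/A| - δ_U(Bx) - |By|)` is finite. -/
def stepSubmodule {k : ℕ} (U : Set (Fin k → ℝ)) (A B : ℝ) :
    Submodule ℂ ((Fin k → ℂ) → ℂ) where
  carrier := {f | Differentiable ℂ f ∧ BddAbove (Set.range fun z => ‖f z‖ * coneWeight U A B z)}
  zero_mem' := ⟨differentiable_const 0, 0, by rintro _ ⟨z, rfl⟩; simp⟩
  add_mem' := by
    rintro f g ⟨hf, a, ha⟩ ⟨hg, b, hb⟩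
    refine ⟨hf.add hg, a + b, ?_⟩
    rintro _ ⟨z, rfl⟩
    have h1 : ‖f z‖ * coneWeight U A B z ≤ a := ha ⟨z, rfl⟩
    have h2 : ‖g z‖ * coneWeight U A B z ≤ b := hb ⟨z, rfl⟩
    have h3 := mul_le_mul_of_nonneg_right (norm_add_le (f z) (g z)) (coneWeight_pos U A B z).le
    simp only [Pi.add_apply]
    linarith
  smul_mem' := by
    rintro c f ⟨hf, a, ha⟩
    refine ⟨hf.const_smul c, ‖c‖ * a, ?_⟩
    rintro _ ⟨z, rfl⟩
    have h1 : ‖f z‖ * coneWeight U A B z ≤ a := ha ⟨z, rfl⟩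
    have h2 := mul_le_mul_of_nonneg_left h1 (norm_nonneg c)
    simp only [Pi.smul_apply, norm_smul]
    linarith

/-- The space `S^{0,B}_{1,A}(U)`. -/
def StepSpace {k : ℕ} (U : Set (Fin k → ℝ)) (A B : ℝ) : Type := ↥(stepSubmodule U A B)

section StepSpace

variable {k : ℕ} (U : Set (Fin k → ℝ)) (A B : ℝ)

noncomputable instance : AddCommGroup (StepSpace U A B) :=
  inferInstanceAs (AddCommGroup ↥(stepSubmodule U A B))

noncomputable instance : Module ℂ (StepSpace U A B) :=
  inferInstanceAs (Module ℂ ↥(stepSubmodule U A B))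

/-- The norm `sup_z |f(z)| exp (|x/A| - δ_U(Bx) - |By|)`. -/
noncomputable instance : Norm (StepSpace U A B) :=
  ⟨fun f => ⨆ z, ‖f.1 z‖ * coneWeight U A B z⟩

theorem stepSpace_core : NormedSpace.Core ℂ (StepSpace U A B) where
  norm_nonneg f := Real.iSup_nonneg fun z => mul_nonneg (norm_nonneg _) (coneWeight_pos U A B z).le
  norm_smul c f := by
    change (⨆ z, ‖c * f.1 z‖ * coneWeight U A B z) = ‖c‖ * ⨆ z, ‖f.1 z‖ * coneWeight U A B z
    rw [Real.mul_iSup_of_nonneg (norm_nonneg c)]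
    simp only [norm_mul, mul_assoc]
  norm_triangle f g := by
    refine ciSup_le fun z => ?_
    have h1 := le_ciSup f.2.2 z
    have h2 := le_ciSup g.2.2 z
    have h3 := mul_le_mul_of_nonneg_right (norm_add_le (f.1 z) (g.1 z)) (coneWeight_pos U A B z).le
    change ‖f.1 z + g.1 z‖ * coneWeight U A B z ≤
      (⨆ z, ‖f.1 z‖ * coneWeight U A B z) + ⨆ z, ‖g.1 z‖ * coneWeight U A B z
    linarith
  norm_eq_zero_iff f := by
    constructor
    · intro h
      refine Subtype.ext (funext fun z => ?_)
      have h1 : ‖f.1 z‖ * coneWeight U A B z ≤ 0 := h ▸ le_ciSup f.2.2 z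
      have h2 := coneWeight_pos U A B z
      exact norm_le_zero_iff.1 (nonpos_of_mul_nonpos_left h1 h2)
    · rintro rfl
      change (⨆ z : Fin k → ℂ, ‖(0 : ℂ)‖ * coneWeight U A B z) = 0
      simp

noncomputable instance : NormedAddCommGroup (StepSpace U A B) :=
  NormedAddCommGroup.ofCore (stepSpace_core U A B)

noncomputable instance : NormedSpace ℂ (StepSpace U A B) :=
  NormedSpace.ofCore (stepSpace_core U A B)

end StepSpace

/-! ### The spaces `S^0_1(U)` -/

/-- The indices `(W, A, B)`, with `W` a conic neighborhood of `U` and `A, B > 0`. -/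
structure StepIndex {k : ℕ} (U : Set (Fin k → ℝ)) where
  W : Set (Fin k → ℝ)
  A : ℝ
  B : ℝ
  isConicNhd : IsConicNhd W U
  A_pos : 0 < A
  B_pos : 0 < B

open Pointwise in
theorem IsCone.infDist_smul {k : ℕ} {W : Set (Fin k → ℝ)} (hW : IsCone W) {t : ℝ} (ht : 0 < t)
    (x : Fin k → ℝ) : Metric.infDist (t • x) W = t * Metric.infDist x W := by
  have h : t • W = W := by
    ext y
    rw [Set.mem_smul_set_iff_inv_smul_mem₀ ht.ne']
    refine ⟨fun hy => ?_, fun hy => hW.2 _ (inv_pos.2 ht) _ hy⟩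
    simpa [smul_smul, ht.ne'] using hW.2 t ht _ hy
  have h2 := infDist_smul₀ ht.ne' W x
  rwa [h, Real.norm_of_nonneg ht.le] at h2

theorem stepSubmodule_mono {k : ℕ} {W W' : Set (Fin k → ℝ)} (hW : IsCone W) (hW' : IsCone W')
    (h : W' ⊆ W) {A A' B B' : ℝ} (hA : 0 < A) (hAA : A ≤ A') (hB : 0 < B) (hBB : B ≤ B') :
    stepSubmodule W A B ≤ stepSubmodule W' A' B' := by
  rintro f ⟨hf, a, ha⟩
  refine ⟨hf, a, ?_⟩
  rintro _ ⟨z, rfl⟩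
  refine le_trans (mul_le_mul_of_nonneg_left (Real.exp_le_exp.2 ?_) (norm_nonneg _)) (ha ⟨z, rfl⟩)
  have hA' := hA.trans_le hAA
  have hB' := hB.trans_le hBB
  set x : Fin k → ℝ := fun j => (z j).re
  set y : Fin k → ℝ := fun j => (z j).im
  rw [hW.infDist_smul hB, hW'.infDist_smul hB', norm_smul, norm_smul, norm_smul, norm_smul,
    Real.norm_of_nonneg (inv_pos.2 hA).le, Real.norm_of_nonneg (inv_pos.2 hA').le,
    Real.norm_of_nonneg hB.le, Real.norm_of_nonneg hB'.le]
  have h1 : A'⁻¹ * ‖x‖ ≤ A⁻¹ * ‖x‖ := by gcongr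
  have h2 : B * Metric.infDist x W ≤ B' * Metric.infDist x W' :=
    mul_le_mul hBB (Metric.infDist_le_infDist_of_subset h hW'.1) Metric.infDist_nonneg hB'.le
  have h3 : B * ‖y‖ ≤ B' * ‖y‖ := by gcongr
  linarith

theorem IsConicNhd.inter {k : ℕ} {U V W : Set (Fin k → ℝ)} (hU : U.Nonempty)
    (hV : IsConicNhd V U) (hW : IsConicNhd W U) : IsConicNhd (V ∩ W) U := by
  have hs : U ⊆ V ∩ W := Set.subset_inter hV.2.1 hW.2.1
  refine ⟨⟨hU.mono hs, fun t ht x hx => ⟨hV.1.2 t ht x hx.1, hW.1.2 t ht x hx.2⟩⟩, hs, ?_⟩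
  have : (V ∩ W) \ {0} = (V \ {0}) ∩ (W \ {0}) := by
    ext x; simp only [Set.mem_sdiff, Set.mem_inter_iff]; tauto
  rw [this]
  exact hV.2.2.inter hW.2.2

/-- The closed cones of `ℝ^k`. -/
structure ClosedCone (k : ℕ) where
  carrier : Set (Fin k → ℝ)
  isCone : IsCone carrier
  isClosed : IsClosed carrier

instance {k : ℕ} : PartialOrder (ClosedCone k) :=
  PartialOrder.lift ClosedCone.carrier (by rintro ⟨_, _, _⟩ ⟨_, _, _⟩ h; congr)

/-- The vector space `⋃_{A, B > 0, W ⊃ K} S^{0,B}_{1,A}(W)`, with `W` running over all conic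
neighborhoods of `K`. -/
def testSubmodule {k : ℕ} (K : ClosedCone k) : Submodule ℂ ((Fin k → ℂ) → ℂ) where
  carrier := {f | ∃ p : StepIndex K.carrier, f ∈ stepSubmodule p.W p.A p.B}
  zero_mem' := ⟨⟨Set.univ, 1, 1, ⟨⟨⟨0, trivial⟩, fun _ _ _ _ => trivial⟩, Set.subset_univ _, by
    simpa [Set.compl_eq_univ_sdiff] using (isOpen_compl_singleton (x := (0 : Fin k → ℝ)))⟩,
    one_pos, one_pos⟩, Submodule.zero_mem _⟩
  add_mem' := by
    rintro f g ⟨p, hf⟩ ⟨q, hg⟩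
    have hn := p.isConicNhd.inter K.isCone.1 q.isConicNhd
    refine ⟨⟨p.W ∩ q.W, max p.A q.A, max p.B q.B, hn, lt_max_of_lt_left p.A_pos,
      lt_max_of_lt_left p.B_pos⟩, Submodule.add_mem _ ?_ ?_⟩
    · exact stepSubmodule_mono p.isConicNhd.1 hn.1 Set.inter_subset_left p.A_pos
        (le_max_left _ _) p.B_pos (le_max_left _ _) hf
    · exact stepSubmodule_mono q.isConicNhd.1 hn.1 Set.inter_subset_right q.A_pos
        (le_max_right _ _) q.B_pos (le_max_right _ _) hg
  smul_mem' := by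
    rintro c f ⟨p, hf⟩
    exact ⟨p, Submodule.smul_mem _ c hf⟩

/-- The test function space `S^0_1(K)`. -/
def TestSpace {k : ℕ} (K : ClosedCone k) : Type := ↥(testSubmodule K)

section TestSpace

variable {k : ℕ} (K : ClosedCone k)

noncomputable instance : AddCommGroup (TestSpace K) :=
  inferInstanceAs (AddCommGroup ↥(testSubmodule K))

noncomputable instance : Module ℂ (TestSpace K) :=
  inferInstanceAs (Module ℂ ↥(testSubmodule K))

/-- The inclusion of `S^{0,B}_{1,A}(W)` in `S^0_1(K)`. -/
noncomputable def stepInclusion (p : StepIndex K.carrier) : StepSpace p.W p.A p.B →ₗ[ℂ] TestSpace K where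
  toFun f := ⟨f.1, p, f.2⟩
  map_add' _ _ := rfl
  map_smul' _ _ := rfl

/-- `S^0_1(K)` carries the inductive limit topology. -/
noncomputable instance : TopologicalSpace (TestSpace K) := lcFinalTopology (stepInclusion K)

instance : IsTopologicalAddGroup (TestSpace K) := (lcFinalTopology_mem (stepInclusion K)).1

instance : ContinuousSMul ℂ (TestSpace K) := (lcFinalTopology_mem (stepInclusion K)).2.1

instance : LocallyConvexSpace ℝ (TestSpace K) := (lcFinalTopology_mem (stepInclusion K)).2.2.1

end TestSpace

/-- A conic neighborhood of `K` is one of any `K' ⊆ K`. -/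
def StepIndex.restrict {k : ℕ} {K' K : ClosedCone k} (h : K' ≤ K) (p : StepIndex K.carrier) :
    StepIndex K'.carrier :=
  ⟨p.W, p.A, p.B, ⟨p.isConicNhd.1, Set.Subset.trans h p.isConicNhd.2.1, p.isConicNhd.2.2⟩,
    p.A_pos, p.B_pos⟩

/-- For `K' ⊆ K`, the inclusion of `S^0_1(K)` in `S^0_1(K')`. -/
noncomputable def testInclusionLinear {k : ℕ} {K' K : ClosedCone k} (h : K' ≤ K) :
    TestSpace K →ₗ[ℂ] TestSpace K' where
  toFun f := ⟨f.1, f.2.elim fun p hp => ⟨p.restrict h, hp⟩⟩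
  map_add' _ _ := rfl
  map_smul' _ _ := rfl

/-- For `K' ⊆ K`, the inclusion of `S^0_1(K)` in `S^0_1(K')` is continuous. -/
noncomputable def testInclusion {k : ℕ} {K' K : ClosedCone k} (h : K' ≤ K) :
    TestSpace K →L[ℂ] TestSpace K' where
  toLinearMap := testInclusionLinear h
  cont := lcFinalTopology_continuous (stepInclusion K) (testInclusionLinear h)
    fun p => (lcFinalTopology_mem (stepInclusion K')).2.2.2 (p.restrict h)

/-- For `K' ⊆ K`, the natural map from `S'^0_1(K')` to `S'^0_1(K)`, taking a functional to its
restriction to `S^0_1(K)`. Here `S'^0_1(K)` is the continuous dual of `S^0_1(K)` with the strong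
topology (uniform convergence on bounded sets), Mathlib's topology on `StrongDual`. -/
noncomputable def dualRestriction {k : ℕ} {K' K : ClosedCone k} (h : K' ≤ K) :
    StrongDual ℂ (TestSpace K') →L[ℂ] StrongDual ℂ (TestSpace K) :=
  ContinuousLinearMap.precomp ℂ (testInclusion h)

/-! ### The spaces `𝓤(M)` -/

/-- The set `𝓟(M)` of all proper closed cones contained in `M`, ordered by inclusion. -/
abbrev ProperSubcone {k : ℕ} (M : ClosedCone k) : Type :=
  {K : ClosedCone k // IsProperCone K.carrier ∧ K ≤ M}

open Classical in
/-- The space `𝓤(M)`: the inductive limit of the spaces `S'^0_1(K)`, `K ∈ 𝓟(M)`, that is, the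
quotient of their direct sum by the subspace spanned by the elements `ι_{K'} u - ι_K ρ_{K',K} u`
with `K' ⊆ K`. -/
def Ultra {k : ℕ} (M : ClosedCone k) : Type :=
  Module.DirectLimit (fun K : ProperSubcone M => StrongDual ℂ (TestSpace K.1))
    (fun _ _ h => (dualRestriction h).toLinearMap)

section Ultra

variable {k : ℕ} (M : ClosedCone k)

open Classical in
noncomputable instance : AddCommGroup (Ultra M) :=
  inferInstanceAs (AddCommGroup (Module.DirectLimit
    (fun K : ProperSubcone M => StrongDual ℂ (TestSpace K.1))
    (fun _ _ h => (dualRestriction h).toLinearMap)))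

open Classical in
noncomputable instance : Module ℂ (Ultra M) :=
  inferInstanceAs (Module ℂ (Module.DirectLimit
    (fun K : ProperSubcone M => StrongDual ℂ (TestSpace K.1))
    (fun _ _ h => (dualRestriction h).toLinearMap)))

open Classical in
/-- The canonical map from `S'^0_1(K)` to `𝓤(M)`, for `K ∈ 𝓟(M)`. -/
noncomputable def ultraOf (K : ProperSubcone M) : StrongDual ℂ (TestSpace K.1) →ₗ[ℂ] Ultra M :=
  Module.DirectLimit.of ℂ (ProperSubcone M)
    (fun K : ProperSubcone M => StrongDual ℂ (TestSpace K.1))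
    (fun _ _ h => (dualRestriction h).toLinearMap) K

/-- The inductive limit topology on `𝓤(M)`: the finest locally convex topology for which all the
canonical maps `S'^0_1(K) → 𝓤(M)` are continuous. -/
@[reducible] noncomputable def ultraTopology : TopologicalSpace (Ultra M) :=
  lcFinalTopology (ultraOf M)

end Ultra

/-! By Hahn–Banach, a locally convex topology with no nonzero continuous functional is trivial, so
it suffices to show that every continuous functional `ℓ` on `𝓤(M)` is zero. Such an `ℓ` pulls back
to a continuous functional on each strong dual `S'^0_1(K)`. It is tested on the evaluations `δ_z`.

Evaluations suffice (`eq_zero_of_evalDual_eq_zero`). A bounded set of test functions lies, bounded,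
in a single step, so `ℓ` is dominated by the dual norm of one step (`exists_step_bound`). The
inclusion of a step into the step with larger `A`, `B` is compact, so every functional is
approximated in that dual norm by combinations of evaluations (`exists_mem_span_evalDual`).

The function `G(z) = ℓ(δ_z)` vanishes (`ultraOf_evalDual_eq_zero`). It does not depend on `K`,
because every `δ_z` already comes from the cone `{0}`. It is entire on complex lines and is bounded
by a multiple of the inverse weight of some step of `K`, for each `K`. If `M` contains a line of
direction `v`, it contains the rays along `v` and `-v`, each a proper cone. Taking `K` to be one ray
and then the other, `ζ ↦ G(w + ζv)` decays exponentially as `Re ζ → ±∞`, with at most exponential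
growth in `|Im ζ|`. A Phragmén–Lindelöf type argument forces such a function to vanish
(`eq_zero_at_I_of_norm_le_exp`). -/

/-! ### Entire functions -/

section Entire

open Complex Metric Set Filter Topology

/-- For `Im z ≥ 0` the point `-iz` lies in the closed right half-plane, so it meets the cut of the
logarithm only at `0`, where the factor `z` restores continuity. -/
theorem continuous_mul_log_neg_I_mul :
    ContinuousOn (fun z : ℂ => z * log (-I * z)) {z | 0 ≤ z.im} := by
  intro z hz
  rcases eq_or_ne z 0 with rfl | h0
  · refine ContinuousAt.continuousWithinAt ?_
    have h1 : Tendsto (fun z : ℂ => |‖z‖ * Real.log ‖z‖| + ‖z‖ * Real.pi) (𝓝 0) (𝓝 0) := by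
      have : Continuous fun z : ℂ => |‖z‖ * Real.log ‖z‖| + ‖z‖ * Real.pi :=
        ((Real.continuous_mul_log.comp continuous_norm).abs).add (continuous_norm.mul_const _)
      simpa using this.tendsto 0
    have h2 : Tendsto (fun z : ℂ => z * log (-I * z)) (𝓝 0) (𝓝 0) := by
      refine squeeze_zero_norm (fun z => ?_) h1
      have h3 : ‖log (-I * z)‖ ≤ |Real.log ‖z‖| + Real.pi := by
        refine (Complex.norm_le_abs_re_add_abs_im _).trans ?_
        rw [log_re, log_im]
        simpa using abs_arg_le_pi (-(I * z))
      calc ‖z * log (-I * z)‖ = ‖z‖ * ‖log (-I * z)‖ := norm_mul _ _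
        _ ≤ ‖z‖ * (|Real.log ‖z‖| + Real.pi) := by gcongr
        _ = |‖z‖ * Real.log ‖z‖| + ‖z‖ * Real.pi := by rw [abs_mul, abs_norm]; ring
    simpa [ContinuousAt] using h2
  · refine ContinuousAt.continuousWithinAt ?_
    refine continuousAt_id.mul (ContinuousAt.clog (by fun_prop) ?_)
    rw [mem_slitPlane_iff]
    have hre : (-I * z).re = z.im := by simp
    have him : (-I * z).im = -z.re := by simp
    rw [hre, him]
    rcases (show 0 ≤ z.im from hz).lt_or_eq with h | h
    · exact Or.inl h
    · exact Or.inr fun h' => h0 (Complex.ext (by simpa using h') h.symm)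

theorem re_mul_log_neg_I_mul (z : ℂ) (c s : ℝ) :
    (I * c * (z * log (-I * z) - s * z)).re
      = c * (z.im * (s - Real.log ‖z‖) - z.re * arg (-I * z)) := by
  have h : ‖-I * z‖ = ‖z‖ := by simp
  simp only [mul_re, mul_im, sub_re, sub_im, log_re, log_im, h, ofReal_re, ofReal_im, I_re, I_im]
  ring

/-- A function decaying exponentially in both horizontal directions of the upper half-plane
vanishes there: its product with `exp (i (a/π) z (log (-iz) - log R))` is bounded on the half-disc
of radius `R` by a constant that does not depend on `R`. -/
theorem eq_zero_at_I_of_norm_le_exp {g : ℂ → ℂ} (hg : Differentiable ℂ g) {a b C : ℝ} (ha : 0 < a)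
    (h : ∀ z : ℂ, ‖g z‖ ≤ C * Real.exp (-a * |z.re| + b * |z.im|)) : g I = 0 := by
  have hpi := Real.pi_pos
  have hC : 0 ≤ C := by
    have := (norm_nonneg _).trans (h 0)
    exact nonneg_of_mul_nonneg_left this (Real.exp_pos _)
  have key : ∀ R : ℝ, 1 < R → ‖g I‖ ≤ C * Real.exp b * Real.exp (-(a / Real.pi) * Real.log R) := by
    intro R hR
    -- With `z = x + iy`, `Re φ = (a/π)(y (log R - log |z|) - x arg(-iz))`. The first term vanishes
    -- on the real axis and on the arc `|z| = R`, and the crude bound `|arg| ≤ π` leaves `Re φ ≤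
    -- a|x|`, which the decay of `g` absorbs. At `i`, `Re φ = (a/π) log R`, which tends to infinity
    -- with `R`.
    set φ : ℂ → ℂ := fun z => I * (a / Real.pi : ℝ) * (z * log (-I * z) - (Real.log R : ℝ) * z)
      with hφ
    set U : Set ℂ := ball 0 R ∩ {z | 0 < z.im} with hU
    have hUc : closure U ⊆ closedBall 0 R ∩ {z | 0 ≤ z.im} :=
      (closure_inter_subset_inter_closure _ _).trans
        (inter_subset_inter closure_ball_subset_closedBall
          (closure_lt_subset_le continuous_const continuous_im))
    set F : ℂ → ℂ := fun z => g z * exp (I * b * z) * exp (φ z) with hF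
    have hnF : ∀ z : ℂ, 0 ≤ z.im → ‖F z‖ = ‖g z‖ * Real.exp (-b * z.im) * Real.exp ((a / Real.pi) *
        (z.im * (Real.log R - Real.log ‖z‖) - z.re * arg (-I * z))) := by
      intro z hz
      rw [hF]
      simp only [norm_mul, norm_exp, hφ]
      rw [re_mul_log_neg_I_mul]
      congr 3
      simp
    have hd : DiffContOnCl ℂ F U := by
      refine ⟨?_, ?_⟩
      · refine (hg.differentiableOn.mul (by fun_prop)).mul (DifferentiableOn.cexp ?_)
        refine DifferentiableOn.const_mul (DifferentiableOn.sub (differentiableOn_id.mul ?_)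
          (by fun_prop)) _
        refine DifferentiableOn.clog (by fun_prop) fun z hz => ?_
        rw [mem_slitPlane_iff]
        left
        simpa using hz.2
      · refine (hg.continuous.continuousOn.mul (by fun_prop)).mul (ContinuousOn.cexp ?_)
        refine ContinuousOn.mul continuousOn_const (ContinuousOn.sub ?_ (by fun_prop))
        exact continuous_mul_log_neg_I_mul.mono fun z hz => (hUc hz).2
    have hfr : ∀ z ∈ frontier U, ‖F z‖ ≤ C := by
      intro z hz
      have hz1 := hUc (frontier_subset_closure hz)
      have hz2 : z.im * (Real.log R - Real.log ‖z‖) = 0 := by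
        rcases frontier_inter_subset _ _ hz with h1 | h1
        · have := frontier_ball_subset_sphere h1.1
          rw [mem_sphere_zero_iff_norm] at this
          rw [this]; simp
        · have := h1.2
          rw [Complex.frontier_setOfPred_lt_im] at this
          rw [show z.im = 0 from this]; simp
      have hz3 : 0 ≤ z.im := hz1.2
      rw [hnF z hz3, hz2]
      have h4 : -(z.re * arg (-I * z)) ≤ |z.re| * Real.pi := by
        refine (neg_le_abs _).trans ?_
        rw [abs_mul]
        gcongr
        exact abs_arg_le_pi _
      have h5 : (a / Real.pi) * (0 - z.re * arg (-I * z)) ≤ a * |z.re| := by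
        calc (a / Real.pi) * (0 - z.re * arg (-I * z)) ≤ (a / Real.pi) * (|z.re| * Real.pi) := by
              gcongr; linarith
          _ = a * |z.re| := by field_simp
      calc ‖g z‖ * Real.exp (-b * z.im) * Real.exp ((a / Real.pi) * (0 - z.re * arg (-I * z)))
          ≤ C * Real.exp (-a * |z.re| + b * |z.im|) * Real.exp (-b * z.im) *
            Real.exp (a * |z.re|) := by
              gcongr
              exact h z
        _ = C := by
          rw [mul_assoc, mul_assoc, ← Real.exp_add, ← Real.exp_add, abs_of_nonneg hz3]
          ring_nf
          simp
    have hI : I ∈ closure U := subset_closure (by simp [hU, hR])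
    have := norm_le_of_forall_mem_frontier_norm_le
      ((isBounded_ball (x := (0 : ℂ)) (r := R)).subset inter_subset_left) hd hfr hI
    rw [hnF I (by simp)] at this
    simp only [I_im, norm_I, Real.log_one, I_re, zero_mul, sub_zero, mul_one, one_mul] at this
    calc ‖g I‖ = (‖g I‖ * Real.exp (-b) * Real.exp (a / Real.pi * Real.log R)) * Real.exp b *
          Real.exp (-(a / Real.pi) * Real.log R) := by
          rw [mul_assoc, mul_assoc, mul_assoc, ← Real.exp_add, ← Real.exp_add, ← Real.exp_add]
          ring_nf; simp
      _ ≤ _ := by gcongr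
  have hlim : Tendsto (fun R : ℝ => C * Real.exp b * Real.exp (-(a / Real.pi) * Real.log R)) atTop
      (𝓝 (C * Real.exp b * 0)) := by
    refine Tendsto.const_mul _ (Real.tendsto_exp_atBot.comp ?_)
    exact Real.tendsto_log_atTop.const_mul_atTop_of_neg (by simpa using div_pos ha hpi)
  rw [mul_zero] at hlim
  have : ‖g I‖ ≤ 0 := ge_of_tendsto hlim ((eventually_gt_atTop 1).mono key)
  exact norm_le_zero_iff.1 this

/-- Cauchy's estimate bounds the remainder by `3M` on the unit disc, and the Schwarz lemma for a
zero of order two gives the square. The constant depends on `g` only through `M`, so the estimate is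
uniform on bounded sets of a step. -/
theorem norm_sub_sub_mul_deriv_le {g : ℂ → ℂ} (hg : Differentiable ℂ g) {c z : ℂ} {M : ℝ}
    (hM : ∀ w ∈ closedBall c 1, ‖g w‖ ≤ M) (hz : z ∈ ball c 1) :
    ‖g z - g c - (z - c) * deriv g c‖ ≤ 3 * M * ‖z - c‖ ^ 2 := by
  have hder : ‖deriv g c‖ ≤ M := by
    simpa using norm_deriv_le_of_forall_mem_sphere_norm_le one_pos hg.diffContOnCl
      fun w hw => hM w (sphere_subset_closedBall hw)
  set q : ℂ → ℂ := fun w => g w - g c - (w - c) * deriv g c with hq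
  have hqc : q c = 0 := by simp [hq]
  have hmaps : MapsTo q (ball c 1) (closedBall (q c) (3 * M)) := by
    intro w hw
    rw [hqc, mem_closedBall_zero_iff]
    have h1 := hM w (ball_subset_closedBall hw)
    have h2 := hM c (mem_closedBall_self zero_le_one)
    rw [mem_ball_iff_norm] at hw
    have h3 : ‖(w - c) * deriv g c‖ ≤ 1 * M := by rw [norm_mul]; gcongr
    calc ‖q w‖ ≤ ‖g w‖ + ‖g c‖ + ‖(w - c) * deriv g c‖ :=
          (norm_sub_le _ _).trans (by gcongr; exact norm_sub_le _ _)
      _ ≤ 3 * M := by linarith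
  have ho : (fun w => q w - q c) =o[𝓝 c] fun w => ‖w - c‖ ^ 1 := by
    have := (hg c).hasDerivAt.isLittleO
    simp only [hqc, sub_zero, pow_one]
    exact this.norm_right
  have := dist_le_mul_div_pow_of_mapsTo_ball_of_isLittleO (n := 1) (R₁ := 1) (by fun_prop) hmaps ho hz
  simpa [hqc, dist_eq_norm] using this

end Entire

/-! ### Cones and weights -/

section Weights

open Metric Set Filter Topology

variable {k : ℕ}

theorem IsCone.zero_mem_closure {W : Set (Fin k → ℝ)} (hW : IsCone W) : (0 : Fin k → ℝ) ∈ closure W := by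
  obtain ⟨x, hx⟩ := hW.1
  have h1 : Tendsto (fun t : ℝ => t • x) (𝓝[>] 0) (𝓝 0) := by
    have : Continuous fun t : ℝ => t • x := by fun_prop
    simpa using (this.tendsto 0).mono_left nhdsWithin_le_nhds
  exact mem_closure_of_tendsto h1 (by filter_upwards [self_mem_nhdsWithin] with t ht using hW.2 t ht x hx)

theorem ClosedCone.zero_mem (K : ClosedCone k) : (0 : Fin k → ℝ) ∈ K.carrier :=
  K.isClosed.closure_eq ▸ K.isCone.zero_mem_closure

theorem ClosedCone.smul_mem (K : ClosedCone k) {t : ℝ} (ht : 0 ≤ t) {x : Fin k → ℝ}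
    (hx : x ∈ K.carrier) : t • x ∈ K.carrier := by
  rcases ht.eq_or_lt with rfl | ht
  · simpa using K.zero_mem
  · exact K.isCone.2 t ht x hx

theorem IsCone.infDist_le_norm {W : Set (Fin k → ℝ)} (hW : IsCone W) (x : Fin k → ℝ) :
    infDist x W ≤ ‖x‖ := by
  rw [← infDist_closure, ← dist_zero_right]
  exact infDist_le_dist_of_mem hW.zero_mem_closure

theorem norm_re_le (z : Fin k → ℂ) : ‖fun j => (z j).re‖ ≤ ‖z‖ :=
  (pi_norm_le_iff_of_nonneg (norm_nonneg _)).2 fun j =>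
    (Complex.abs_re_le_norm _).trans (norm_le_pi_norm z j)

theorem norm_im_le (z : Fin k → ℂ) : ‖fun j => (z j).im‖ ≤ ‖z‖ :=
  (pi_norm_le_iff_of_nonneg (norm_nonneg _)).2 fun j =>
    (Complex.abs_im_le_norm _).trans (norm_le_pi_norm z j)

theorem norm_le_re_add_im (z : Fin k → ℂ) :
    ‖z‖ ≤ ‖fun j => (z j).re‖ + ‖fun j => (z j).im‖ :=
  (pi_norm_le_iff_of_nonneg (by positivity)).2 fun j =>
    (Complex.norm_le_abs_re_add_abs_im _).trans (add_le_add
      (norm_le_pi_norm (fun j => (z j).re) j) (norm_le_pi_norm (fun j => (z j).im) j))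

theorem coneWeight_eq {W : Set (Fin k → ℝ)} (hW : IsCone W) {A B : ℝ} (hA : 0 < A) (hB : 0 < B)
    (z : Fin k → ℂ) : coneWeight W A B z = Real.exp (A⁻¹ * ‖fun j => (z j).re‖ -
      B * infDist (fun j => (z j).re) W - B * ‖fun j => (z j).im‖) := by
  rw [coneWeight, hW.infDist_smul hB, norm_smul, norm_smul, Real.norm_of_nonneg (inv_pos.2 hA).le,
    Real.norm_of_nonneg hB.le]

theorem coneWeight_anti {W W' : Set (Fin k → ℝ)} (hW : IsCone W) (hW' : IsCone W')
    (h : W' ⊆ W) {A A' B B' : ℝ} (hA : 0 < A) (hAA : A ≤ A') (hB : 0 < B) (hBB : B ≤ B')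
    (z : Fin k → ℂ) : coneWeight W' A' B' z ≤ coneWeight W A B z := by
  rw [coneWeight_eq hW hA hB, coneWeight_eq hW' (hA.trans_le hAA) (hB.trans_le hBB)]
  refine Real.exp_le_exp.2 ?_
  have h2 : B * infDist (fun j => (z j).re) W ≤ B' * infDist (fun j => (z j).re) W' :=
    mul_le_mul hBB (infDist_le_infDist_of_subset h hW'.1) infDist_nonneg (hB.le.trans hBB)
  gcongr

/-- Raising `A` and `B` by one gains `(1/A - 1/(A+1))|x|` and `|y|` in the exponent, while the
distance term only helps. This decay at infinity is half of the compactness of the inclusions. -/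
theorem exists_coneWeight_succ_le {W : Set (Fin k → ℝ)} (hW : IsCone W) {A B : ℝ} (hA : 0 < A)
    (hB : 0 < B) : ∃ c > 0, ∀ z : Fin k → ℂ,
      coneWeight W (A + 1) (B + 1) z ≤ Real.exp (-c * ‖z‖) * coneWeight W A B z := by
  have hlt : (A + 1)⁻¹ < A⁻¹ := by gcongr; linarith
  refine ⟨min (A⁻¹ - (A + 1)⁻¹) 1, lt_min (sub_pos.2 hlt) one_pos, fun z => ?_⟩
  rw [coneWeight_eq hW hA hB, coneWeight_eq hW (by linarith) (by linarith), ← Real.exp_add]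
  refine Real.exp_le_exp.2 ?_
  set x := ‖fun j => (z j).re‖
  set y := ‖fun j => (z j).im‖
  have hx : 0 ≤ x := norm_nonneg _
  have hy : 0 ≤ y := norm_nonneg _
  have hd : 0 ≤ infDist (fun j => (z j).re) W := infDist_nonneg
  have h1 := mul_le_mul_of_nonneg_left (norm_le_re_add_im z)
    (lt_min (sub_pos.2 hlt) one_pos).le
  have h2 := mul_le_mul_of_nonneg_right (min_le_left (A⁻¹ - (A + 1)⁻¹) 1) hx
  have h3 := mul_le_mul_of_nonneg_right (min_le_right (A⁻¹ - (A + 1)⁻¹) 1) hy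
  linarith

theorem coneWeight_le {W : Set (Fin k → ℝ)} (hW : IsCone W) {A B : ℝ} (hA : 0 < A) (hB : 0 < B)
    (z : Fin k → ℂ) : coneWeight W A B z ≤ Real.exp (A⁻¹ * ‖z‖) := by
  rw [coneWeight_eq hW hA hB]
  refine Real.exp_le_exp.2 ?_
  have h1 := mul_le_mul_of_nonneg_left (norm_re_le z) (inv_pos.2 hA).le
  have h2 : 0 ≤ B * infDist (fun j => (z j).re) W := mul_nonneg hB.le infDist_nonneg
  have h3 : 0 ≤ B * ‖fun j => (z j).im‖ := mul_nonneg hB.le (norm_nonneg _)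
  linarith

/-- One `B` pays for `δ_W(x) ≤ |x|`, which holds because `0` is in the closure of `W`; the other
pays for `|y|`. -/
theorem inv_coneWeight_le {W : Set (Fin k → ℝ)} (hW : IsCone W) {A B : ℝ} (hA : 0 < A) (hB : 0 < B)
    (z : Fin k → ℂ) : (coneWeight W A B z)⁻¹ ≤ Real.exp (2 * B * ‖z‖) := by
  rw [coneWeight_eq hW hA hB, ← Real.exp_neg]
  refine Real.exp_le_exp.2 ?_
  have h1 : 0 ≤ A⁻¹ * ‖fun j => (z j).re‖ := mul_nonneg (inv_pos.2 hA).le (norm_nonneg _)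
  have h2 := mul_le_mul_of_nonneg_left ((hW.infDist_le_norm _).trans (norm_re_le z)) hB.le
  have h3 := mul_le_mul_of_nonneg_left (norm_im_le z) hB.le
  linarith

/-- On a complex line directed by a vector `v` of `W`, the inverse weight decays exponentially in
the direction of `v`. -/
theorem exists_inv_coneWeight_line_le {W : Set (Fin k → ℝ)} (hW : IsCone W) {A B : ℝ} (hA : 0 < A)
    (hB : 0 < B) {v : Fin k → ℝ} (hv : v ≠ 0) (hvW : v ∈ W) (w : Fin k → ℂ) :
    ∃ a > 0, ∃ b C : ℝ, 0 ≤ b ∧ 0 ≤ C ∧ ∀ ζ : ℂ, 0 ≤ ζ.re →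
      (coneWeight W A B (w + ζ • fun j => (v j : ℂ)))⁻¹ ≤
        C * Real.exp (-a * |ζ.re| + b * |ζ.im|) := by
  refine ⟨A⁻¹ * ‖v‖, mul_pos (inv_pos.2 hA) (norm_pos_iff.2 hv), B * ‖v‖,
    Real.exp ((A⁻¹ + 2 * B) * ‖w‖), by positivity, by positivity, fun ζ hζ => ?_⟩
  have hre : (fun j => ((w + ζ • fun j => (v j : ℂ)) j).re) = (fun j => (w j).re) + ζ.re • v := by
    ext j; simp
  have him : (fun j => ((w + ζ • fun j => (v j : ℂ)) j).im) = (fun j => (w j).im) + ζ.im • v := by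
    ext j; simp
  rw [coneWeight_eq hW hA hB, ← Real.exp_neg, ← Real.exp_add, hre, him]
  refine Real.exp_le_exp.2 ?_
  set x : Fin k → ℝ := fun j => (w j).re
  set y : Fin k → ℝ := fun j => (w j).im
  have hx : ‖x‖ ≤ ‖w‖ := norm_re_le w
  have hy : ‖y‖ ≤ ‖w‖ := norm_im_le w
  -- The point `Re ζ • v` stays in the closure of `W`, so the distance of the real part to `W` is at
  -- most `‖w‖`, while its norm grows linearly in `Re ζ`.
  have hmem : ζ.re • v ∈ closure W := by
    rcases hζ.eq_or_lt with h | h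
    · rw [← h, zero_smul]; exact hW.zero_mem_closure
    · exact subset_closure (hW.2 _ h _ hvW)
  have h1 : infDist (x + ζ.re • v) W ≤ ‖w‖ := by
    rw [← infDist_closure]
    refine (infDist_le_dist_of_mem hmem).trans ?_
    simpa [dist_eq_norm] using hx
  have h2 : ‖y + ζ.im • v‖ ≤ ‖w‖ + |ζ.im| * ‖v‖ := by
    refine (norm_add_le _ _).trans ?_
    rw [norm_smul, Real.norm_eq_abs]
    linarith
  have h3 : |ζ.re| * ‖v‖ - ‖w‖ ≤ ‖x + ζ.re • v‖ := by
    have := norm_sub_le (x + ζ.re • v) x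
    rw [add_sub_cancel_left, norm_smul, Real.norm_eq_abs] at this
    linarith
  have e1 := mul_le_mul_of_nonneg_left h1 hB.le
  have e2 := mul_le_mul_of_nonneg_left h2 hB.le
  have e3 := mul_le_mul_of_nonneg_left h3 (inv_pos.2 hA).le
  linarith

/-! ### A cofinal sequence of steps -/

/-- The conic neighborhood `{x | δ_K(x) < |x| / (n + 1)} ∪ {0}` of `K`. -/
def thinCone (K : ClosedCone k) (n : ℕ) : Set (Fin k → ℝ) :=
  insert 0 {x | infDist x K.carrier < ((n : ℝ) + 1)⁻¹ * ‖x‖}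

theorem isConicNhd_thinCone (K : ClosedCone k) (n : ℕ) : IsConicNhd (thinCone K n) K.carrier := by
  have hn : (0 : ℝ) < ((n : ℝ) + 1)⁻¹ := by positivity
  refine ⟨⟨⟨0, mem_insert _ _⟩, ?_⟩, ?_, ?_⟩
  · rintro t ht x (rfl | hx)
    · simp [thinCone]
    · right
      change infDist _ _ < _
      rw [K.isCone.infDist_smul ht, norm_smul, Real.norm_of_nonneg ht.le, mul_left_comm]
      exact mul_lt_mul_of_pos_left hx ht
  · intro x hx
    rcases eq_or_ne x 0 with rfl | h0
    · exact mem_insert _ _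
    · right
      change infDist _ _ < _
      rw [infDist_zero_of_mem hx]
      exact mul_pos hn (norm_pos_iff.2 h0)
  · have : thinCone K n \ {0} = {x | infDist x K.carrier < ((n : ℝ) + 1)⁻¹ * ‖x‖} := by
      ext x
      simp only [thinCone, Set.mem_sdiff, mem_insert_iff, mem_singleton_iff, mem_ofPred_eq]
      refine ⟨fun h => h.1.resolve_left h.2, fun h => ⟨Or.inr h, ?_⟩⟩
      rintro rfl
      simp [infDist_zero_of_mem K.zero_mem] at h
    rw [this]
    exact isOpen_lt (continuous_infDist_pt _) (by fun_prop)

theorem thinCone_antitone (K : ClosedCone k) : Antitone (thinCone K) := by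
  intro m n h
  refine insert_subset_insert fun x hx => ?_
  rw [mem_ofPred_eq] at hx ⊢
  refine hx.trans_le ?_
  gcongr

/-- The part of the unit sphere outside `W` is compact and disjoint from `K`, so its distance to `K`
is positive; homogeneity extends this to all `x`. -/
theorem exists_thinCone_subset (K : ClosedCone k) {W : Set (Fin k → ℝ)}
    (hW : IsConicNhd W K.carrier) : ∃ n, thinCone K n ⊆ W := by
  have hcomp : IsCompact (sphere (0 : Fin k → ℝ) 1 \ (W \ {0})) :=
    (isCompact_sphere (0 : Fin k → ℝ) 1).diff hW.2.2
  obtain ⟨m, hm, hmin⟩ : ∃ m : ℝ, 0 < m ∧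
      ∀ x ∈ sphere (0 : Fin k → ℝ) 1 \ (W \ {0}), m ≤ infDist x K.carrier := by
    rcases (sphere (0 : Fin k → ℝ) 1 \ (W \ {0})).eq_empty_or_nonempty with h | h
    · exact ⟨1, one_pos, by simp [h]⟩
    · obtain ⟨x₀, hx₀, hle⟩ := hcomp.exists_isMinOn h
        (continuous_infDist_pt K.carrier).continuousOn
      refine ⟨_, (K.isClosed.notMem_iff_infDist_pos K.isCone.1).1 fun hK => hx₀.2 ⟨hW.2.1 hK, ?_⟩,
        fun x hx => hle hx⟩
      rintro rfl
      simp at hx₀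
  obtain ⟨n, hn⟩ := exists_nat_one_div_lt hm
  refine ⟨n, ?_⟩
  rintro x (rfl | hx)
  · exact hW.2.1 K.zero_mem
  by_contra hxW
  have hx0 : x ≠ 0 := by
    rintro rfl
    exact hxW (hW.2.1 K.zero_mem)
  have hpos : 0 < ‖x‖⁻¹ := inv_pos.2 (norm_pos_iff.2 hx0)
  have h1 : ‖x‖⁻¹ • x ∈ sphere (0 : Fin k → ℝ) 1 \ (W \ {0}) := by
    refine ⟨by simp [norm_smul, hx0], fun h => hxW ?_⟩
    have := hW.1.2 ‖x‖ (norm_pos_iff.2 hx0) _ h.1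
    rwa [smul_smul, mul_inv_cancel₀ (norm_ne_zero_iff.2 hx0), one_smul] at this
  have h2 := hmin _ h1
  rw [K.isCone.infDist_smul hpos] at h2
  have h3 : infDist x K.carrier < ((n : ℝ) + 1)⁻¹ * ‖x‖ := hx
  have h4 : ‖x‖⁻¹ * infDist x K.carrier < ((n : ℝ) + 1)⁻¹ := by
    rw [inv_mul_lt_iff₀ (norm_pos_iff.2 hx0), mul_comm]; exact h3
  rw [one_div] at hn
  linarith

/-- The steps `S^{0,n+1}_{1,n+1}(W_n)`, with `W_n` the thin cones around `K`. -/
noncomputable def thinStep (K : ClosedCone k) (n : ℕ) : StepIndex K.carrier :=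
  ⟨thinCone K n, n + 1, n + 1, isConicNhd_thinCone K n, by positivity, by positivity⟩

/-- The weight of the step `p`. -/
noncomputable def StepIndex.weight {U : Set (Fin k → ℝ)} (p : StepIndex U) (z : Fin k → ℂ) : ℝ :=
  coneWeight p.W p.A p.B z

theorem StepIndex.weight_pos {U : Set (Fin k → ℝ)} (p : StepIndex U) (z : Fin k → ℂ) :
    0 < p.weight z := coneWeight_pos _ _ _ _

theorem thinStep_weight_antitone (K : ClosedCone k) (z : Fin k → ℂ) :
    Antitone fun n => (thinStep K n).weight z := by
  intro m n h
  have h' : (m : ℝ) + 1 ≤ n + 1 := by gcongr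
  exact coneWeight_anti (isConicNhd_thinCone K m).1 (isConicNhd_thinCone K n).1
    (thinCone_antitone K h) (by positivity) h' (by positivity) h' z

/-- Countable cofinality of the steps, which makes a diagonal argument over `n` possible. -/
theorem exists_thinStep_weight_le (K : ClosedCone k) (p : StepIndex K.carrier) :
    ∃ n, ∀ z, (thinStep K n).weight z ≤ p.weight z := by
  obtain ⟨n, hn⟩ := exists_thinCone_subset K p.isConicNhd
  obtain ⟨a, ha⟩ := exists_nat_ge p.A
  obtain ⟨b, hb⟩ := exists_nat_ge p.B
  refine ⟨n + a + b, fun z => ?_⟩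
  have hn0 : (0 : ℝ) ≤ n := by positivity
  have ha0 : (0 : ℝ) ≤ a := by positivity
  have hb0 : (0 : ℝ) ≤ b := by positivity
  refine coneWeight_anti p.isConicNhd.1 (isConicNhd_thinCone K _).1
    ((thinCone_antitone K (by omega)).trans hn) p.A_pos ?_ p.B_pos ?_ z
  · simp only [thinStep]; push_cast; linarith
  · simp only [thinStep]; push_cast; linarith

end Weights

/-! ### The test spaces and their duals -/

section Duals

open Metric Set Filter Topology
open scoped ENNReal

variable {k : ℕ}

/-- The element of a step given by a function. -/
def StepSpace.mk {U : Set (Fin k → ℝ)} {A B : ℝ} (f : (Fin k → ℂ) → ℂ)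
    (hf : f ∈ stepSubmodule U A B) : StepSpace U A B := ⟨f, hf⟩

theorem StepSpace.norm_apply_mul_le {U : Set (Fin k → ℝ)} {A B : ℝ} (f : StepSpace U A B)
    (z : Fin k → ℂ) : ‖f.1 z‖ * coneWeight U A B z ≤ ‖f‖ :=
  le_ciSup f.2.2 z

theorem StepSpace.norm_apply_le {U : Set (Fin k → ℝ)} {A B : ℝ} (f : StepSpace U A B)
    (z : Fin k → ℂ) : ‖f.1 z‖ ≤ (coneWeight U A B z)⁻¹ * ‖f‖ := by
  rw [inv_mul_eq_div, le_div_iff₀ (coneWeight_pos U A B z)]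
  exact f.norm_apply_mul_le z

theorem StepSpace.norm_le {U : Set (Fin k → ℝ)} {A B : ℝ} (f : StepSpace U A B) {C : ℝ}
    (h : ∀ z, ‖f.1 z‖ * coneWeight U A B z ≤ C) : ‖f‖ ≤ C :=
  ciSup_le h

theorem TestSpace.differentiable {K : ClosedCone k} (h : TestSpace K) : Differentiable ℂ h.1 :=
  h.2.elim fun _ hp => hp.1

theorem TestSpace.continuous_of_bound {K : ClosedCone k} {F : Type*} [NormedAddCommGroup F]
    [NormedSpace ℂ F] (T : TestSpace K →ₗ[ℂ] F)
    (hT : ∀ p : StepIndex K.carrier, ∃ C : ℝ, ∀ h : StepSpace p.W p.A p.B,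
      ‖T (stepInclusion K p h)‖ ≤ C * ‖h‖) : Continuous T := by
  refine lcFinalTopology_continuous (stepInclusion K) T fun p => ?_
  obtain ⟨C, hC⟩ := hT p
  exact ((T ∘ₗ stepInclusion K p).mkContinuous C hC).continuous

/-- A bounded set of `S^0_1(K)` is contained in one of the steps and is bounded there. -/
theorem exists_bound_of_isVonNBounded {K : ClosedCone k} {S : Set (TestSpace K)}
    (hS : Bornology.IsVonNBounded ℂ S) :
    ∃ (p : StepIndex K.carrier) (C : ℝ), ∀ h ∈ S, ∀ z, ‖h.1 z‖ * p.weight z ≤ C := by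
  -- Otherwise there are `h n ∈ S` and points `z n` with `|h n (z n)|` times the `n`-th weight
  -- exceeding `n`. Sampling `f` at the `z n` with these weights is a continuous map to `ℓ^∞`, whose
  -- image of `S` would be unbounded.
  by_contra! hcon
  choose h hhS z hz using fun n : ℕ => hcon (thinStep K n) n
  have hbound : ∀ p : StepIndex K.carrier, ∃ C : ℝ, ∀ f : StepSpace p.W p.A p.B, ∀ n,
      ‖f.1 (z n)‖ * (thinStep K n).weight (z n) ≤ C * ‖f‖ := by
    intro p
    obtain ⟨m, hm⟩ := exists_thinStep_weight_le K p
    have hnn : ∀ n, 0 ≤ (p.weight (z n))⁻¹ * (thinStep K n).weight (z n) := fun n =>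
      mul_nonneg (inv_nonneg.2 (p.weight_pos _).le) ((thinStep K n).weight_pos _).le
    -- The `1` covers all `n ≥ m`, where the thin weight is below that of `p`; the sum covers the
    -- finitely many `n < m`.
    refine ⟨1 + ∑ n ∈ Finset.range m, (p.weight (z n))⁻¹ * (thinStep K n).weight (z n),
      fun f n => ?_⟩
    rcases le_or_gt m n with hmn | hmn
    · calc ‖f.1 (z n)‖ * (thinStep K n).weight (z n) ≤ ‖f.1 (z n)‖ * p.weight (z n) := by
            gcongr
            exact (thinStep_weight_antitone K (z n) hmn).trans (hm _)
        _ ≤ ‖f‖ := f.norm_apply_mul_le _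
        _ ≤ _ := le_mul_of_one_le_left (norm_nonneg _)
            (le_add_of_nonneg_right (Finset.sum_nonneg fun i _ => hnn i))
    · calc ‖f.1 (z n)‖ * (thinStep K n).weight (z n)
          ≤ ((p.weight (z n))⁻¹ * ‖f‖) * (thinStep K n).weight (z n) := by
            have := ((thinStep K n).weight_pos (z n)).le
            gcongr
            exact f.norm_apply_le _
        _ = ((p.weight (z n))⁻¹ * (thinStep K n).weight (z n)) * ‖f‖ := by ring
        _ ≤ _ := by
            gcongr
            refine (Finset.single_le_sum (f := fun n =>
              (p.weight (z n))⁻¹ * (thinStep K n).weight (z n)) (fun i _ => hnn i)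
              (Finset.mem_range.2 hmn)).trans (le_add_of_nonneg_left zero_le_one)
  have hmem : ∀ f : TestSpace K,
      Memℓp (fun n => f.1 (z n) * ((thinStep K n).weight (z n) : ℂ)) ∞ := by
    rintro ⟨f, p, hp⟩
    obtain ⟨C, hC⟩ := hbound p
    refine memℓp_infty ⟨C * ‖StepSpace.mk f hp‖, ?_⟩
    rintro _ ⟨n, rfl⟩
    have := hC (.mk f hp) n
    change ‖f (z n) * ((thinStep K n).weight (z n) : ℂ)‖ ≤ _
    rw [norm_mul, Complex.norm_of_nonneg ((thinStep K n).weight_pos (z n)).le]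
    exact this
  let T : TestSpace K →ₗ[ℂ] lp (fun _ : ℕ => ℂ) ∞ :=
    { toFun := fun f => ⟨fun n => f.1 (z n) * ((thinStep K n).weight (z n) : ℂ), hmem f⟩
      map_add' := fun f g => by
        ext n
        exact add_mul (f.1 (z n)) (g.1 (z n)) _
      map_smul' := fun c f => by
        ext n
        exact mul_assoc c (f.1 (z n)) _ }
  have hTn : ∀ f n, ‖f.1 (z n)‖ * (thinStep K n).weight (z n) = ‖T f n‖ := fun f n => by
    change _ = ‖f.1 (z n) * ((thinStep K n).weight (z n) : ℂ)‖
    simp [abs_of_pos ((thinStep K n).weight_pos (z n))]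
  have hT : Continuous T := by
    refine TestSpace.continuous_of_bound T fun p => ?_
    obtain ⟨C, hC⟩ := hbound p
    refine ⟨C, fun f => lp.norm_le_of_forall_le ?_ fun n => ?_⟩
    · exact (mul_nonneg (norm_nonneg _) ((thinStep K 0).weight_pos _).le).trans (hC f 0)
    · rw [← hTn]
      exact hC f n
  have hb : Bornology.IsBounded (T '' S) :=
    (NormedSpace.isVonNBounded_iff ℂ).1 (hS.image (⟨T, hT⟩ : TestSpace K →L[ℂ] _))
  obtain ⟨C, hC⟩ := hb.exists_norm_le
  obtain ⟨n, hn⟩ := exists_nat_gt C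
  have h1 := hC _ (mem_image_of_mem T (hhS n))
  have h2 := lp.norm_apply_le_norm ENNReal.top_ne_zero (T (h n)) n
  rw [← hTn] at h2
  linarith [hz n]

/-- A continuous functional on the strong dual of `S^0_1(K)` is dominated by the dual norm of one
of the steps. -/
theorem exists_step_bound {K : ClosedCone k} (ℓ : StrongDual ℂ (TestSpace K) →ₗ[ℂ] ℂ)
    (hℓ : Continuous ℓ) :
    ∃ (p : StepIndex K.carrier) (C : ℝ), 0 ≤ C ∧ ∀ (u : StrongDual ℂ (TestSpace K)) (r : ℝ), 0 < r →
      (∀ h : StepSpace p.W p.A p.B, ‖u (stepInclusion K p h)‖ ≤ r * ‖h‖) → ‖ℓ u‖ ≤ C * r := by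
  have h0 : ℓ ⁻¹' ball 0 1 ∈ 𝓝 (0 : StrongDual ℂ (TestSpace K)) :=
    hℓ.continuousAt.preimage_mem_nhds (by simpa using ball_mem_nhds (0 : ℂ) one_pos)
  obtain ⟨⟨S, V⟩, ⟨hS, hV⟩, hSV⟩ := ContinuousLinearMap.hasBasis_nhds_zero.mem_iff.1 h0
  obtain ⟨ε, hε, hεV⟩ := Metric.mem_nhds_iff.1 hV
  obtain ⟨p, C, hC⟩ := exists_bound_of_isVonNBounded hS
  set D : ℝ := max C 0 + 1 with hD
  have hD0 : 0 < D := by positivity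
  have hCD : C ≤ D := (le_max_left _ _).trans (le_add_of_nonneg_right zero_le_one)
  refine ⟨p, 2 * D / ε, by positivity, fun u r hr hu => ?_⟩
  -- Chosen so that `s * (r * D) = ε / 2`, which places `s • u` in the basic neighborhood where `|ℓ|
  -- < 1`.
  set s : ℝ := ε / (2 * r * D) with hs
  have hs0 : 0 < s := by positivity
  have hmem : (s : ℂ) • u ∈ ℓ ⁻¹' ball 0 1 := by
    refine hSV fun h hh => hεV ?_
    have hstep : h.1 ∈ stepSubmodule p.W p.A p.B := by
      refine ⟨h.differentiable, C, ?_⟩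
      rintro _ ⟨z, rfl⟩
      exact hC h hh z
    have h1 := hu (.mk h.1 hstep)
    have h2 : ‖StepSpace.mk h.1 hstep‖ ≤ D :=
      StepSpace.norm_le _ fun z => (hC h hh z).trans hCD
    have h3 : ‖u h‖ ≤ r * D := h1.trans (by gcongr)
    rw [mem_ball_zero_iff]
    change ‖(s : ℂ) * u h‖ < ε
    rw [norm_mul, Complex.norm_of_nonneg hs0.le]
    calc s * ‖u h‖ ≤ s * (r * D) := by gcongr
      _ = ε / 2 := by rw [hs]; field_simp
      _ < ε := by linarith
  have h4 : s * ‖ℓ u‖ < 1 := by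
    have : ‖ℓ ((s : ℂ) • u)‖ < 1 := by simpa using hmem
    rwa [map_smul, norm_smul, Complex.norm_of_nonneg hs0.le] at this
  calc ‖ℓ u‖ ≤ 1 / s := by rw [le_div_iff₀ hs0, mul_comm]; exact h4.le
    _ = 2 * D / ε * r := by rw [hs]; field_simp

/-! ### Evaluations and their holomorphic dependence on the point -/

/-- The evaluation at a point, as a functional on `S^0_1(K)`. -/
noncomputable def evalDual (K : ClosedCone k) (z : Fin k → ℂ) : StrongDual ℂ (TestSpace K) where
  toFun h := h.1 z
  map_add' _ _ := rfl
  map_smul' _ _ := rfl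
  cont := TestSpace.continuous_of_bound
    { toFun := fun h : TestSpace K => h.1 z
      map_add' := fun _ _ => rfl
      map_smul' := fun _ _ => rfl }
    fun _ => ⟨_, fun h => h.norm_apply_le z⟩

theorem differentiable_line {f : (Fin k → ℂ) → ℂ} (hf : Differentiable ℂ f) (w v : Fin k → ℂ) :
    Differentiable ℂ fun ζ : ℂ => f (w + ζ • v) :=
  hf.comp (by fun_prop)

theorem StepSpace.norm_line_le {K : ClosedCone k} (p : StepIndex K.carrier) (w v : Fin k → ℂ)
    (h : StepSpace p.W p.A p.B) :
    ∀ ζ ∈ closedBall (0 : ℂ) 1, ‖h.1 (w + ζ • v)‖ ≤ Real.exp (2 * p.B * (‖w‖ + ‖v‖)) * ‖h‖ := by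
  intro ζ hζ
  have hB := p.B_pos
  rw [mem_closedBall_zero_iff] at hζ
  refine (h.norm_apply_le _).trans ?_
  gcongr
  refine (inv_coneWeight_le p.isConicNhd.1 p.A_pos p.B_pos _).trans ?_
  gcongr
  refine (norm_add_le _ _).trans ?_
  rw [norm_smul]
  have := mul_le_mul_of_nonneg_right hζ (norm_nonneg v)
  linarith

/-- The derivative at `w` in the direction `v`, as a functional on `S^0_1(K)`. -/
noncomputable def derivDual (K : ClosedCone k) (w v : Fin k → ℂ) :
    StrongDual ℂ (TestSpace K) :=
  let T : TestSpace K →ₗ[ℂ] ℂ :=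
    { toFun := fun h => deriv (fun ζ : ℂ => h.1 (w + ζ • v)) 0
      map_add' := fun f g => deriv_fun_add (differentiable_line f.differentiable w v 0)
        (differentiable_line g.differentiable w v 0)
      map_smul' := fun c f => deriv_fun_const_smul (R := ℂ) c (differentiable_line f.differentiable w v 0) }
  ⟨T, TestSpace.continuous_of_bound T fun p => ⟨Real.exp (2 * p.B * (‖w‖ + ‖v‖)), fun h => by
    have := Complex.norm_deriv_le_of_forall_mem_sphere_norm_le (c := 0) one_pos
      (differentiable_line h.2.1 w v).diffContOnCl
      fun ζ hζ => StepSpace.norm_line_le p w v h ζ (sphere_subset_closedBall hζ)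
    rw [div_one] at this
    exact this⟩⟩

/-- The Taylor remainder of `ζ ↦ δ_{w+ζv}` is `O(ζ²)` in the dual norm of the step that controls
`ℓ`, so differentiation passes through `ℓ`. -/
theorem hasDerivAt_evalDual {K : ClosedCone k} (ℓ : StrongDual ℂ (TestSpace K) →ₗ[ℂ] ℂ)
    (hℓ : Continuous ℓ) (w v : Fin k → ℂ) :
    HasDerivAt (fun ζ : ℂ => ℓ (evalDual K (w + ζ • v))) (ℓ (derivDual K w v)) 0 := by
  obtain ⟨p, C, hC0, hC⟩ := exists_step_bound ℓ hℓ
  rw [hasDerivAt_iff_isLittleO]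
  set M := Real.exp (2 * p.B * (‖w‖ + ‖v‖)) with hM
  have hM0 : 0 < M := Real.exp_pos _
  have hO : (fun ζ : ℂ => ℓ (evalDual K (w + ζ • v)) - ℓ (evalDual K (w + (0 : ℂ) • v))
      - (ζ - 0) • ℓ (derivDual K w v)) =O[𝓝 0] fun ζ : ℂ => ζ ^ 2 := by
    refine Asymptotics.IsBigO.of_bound (C * (3 * M)) ?_
    filter_upwards [ball_mem_nhds (0 : ℂ) one_pos] with ζ hζ
    rcases eq_or_ne ζ 0 with rfl | h0
    · simp
    rw [← map_sub, ← map_smul, ← map_sub, mul_assoc]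
    have hpos : 0 < ‖ζ‖ := norm_pos_iff.2 h0
    rw [norm_pow]
    refine hC _ _ (by positivity) fun h => ?_
    have := norm_sub_sub_mul_deriv_le (differentiable_line h.2.1 w v)
      (StepSpace.norm_line_le p w v h) hζ
    calc _ ≤ 3 * (M * ‖h‖) * ‖ζ - 0‖ ^ 2 := this
      _ = _ := by rw [sub_zero]; ring
  refine hO.trans_isLittleO ?_
  simpa using Asymptotics.isLittleO_pow_id (𝕜 := ℂ) one_lt_two

theorem differentiable_evalDual_line {K : ClosedCone k} (ℓ : StrongDual ℂ (TestSpace K) →ₗ[ℂ] ℂ)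
    (hℓ : Continuous ℓ) (w v : Fin k → ℂ) :
    Differentiable ℂ fun ζ : ℂ => ℓ (evalDual K (w + ζ • v)) := by
  intro ζ₀
  have h1 := hasDerivAt_evalDual ℓ hℓ (w + ζ₀ • v) v
  rw [← sub_self ζ₀] at h1
  have h2 := h1.comp_sub_const ζ₀ ζ₀
  refine HasDerivAt.differentiableAt (f' := ℓ (derivDual K (w + ζ₀ • v) v)) ?_
  refine h2.congr_of_eventuallyEq (Eventually.of_forall fun ζ => ?_)
  change ℓ (evalDual K (w + ζ • v)) = ℓ (evalDual K (w + ζ₀ • v + (ζ - ζ₀) • v))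
  rw [sub_smul]
  abel_nf

/-- On a step, the dual norm of `δ_z` is at most the inverse weight at `z`. -/
theorem exists_norm_evalDual_le {K : ClosedCone k} (ℓ : StrongDual ℂ (TestSpace K) →ₗ[ℂ] ℂ)
    (hℓ : Continuous ℓ) : ∃ (p : StepIndex K.carrier) (C : ℝ), 0 ≤ C ∧
      ∀ z, ‖ℓ (evalDual K z)‖ ≤ C * (p.weight z)⁻¹ := by
  obtain ⟨p, C, hC0, hC⟩ := exists_step_bound ℓ hℓ
  exact ⟨p, C, hC0, fun z => hC _ _ (inv_pos.2 (p.weight_pos z)) fun h => h.norm_apply_le z⟩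

/-! ### Compactness of the inclusions and density of evaluations -/

/-- The step with the same cone and larger parameters. -/
noncomputable def StepIndex.succ {U : Set (Fin k → ℝ)} (p : StepIndex U) : StepIndex U :=
  ⟨p.W, p.A + 1, p.B + 1, p.isConicNhd, by linarith [p.A_pos], by linarith [p.B_pos]⟩

/-- The inclusion of a step into the next one is compact: up to `ε`, it depends only on the values
of the functions on a finite set. -/
theorem exists_finite_norm_mul_succ_weight_le {K : ClosedCone k} (p : StepIndex K.carrier) {ε : ℝ}
    (hε : 0 < ε) : ∃ Z : Set (Fin k → ℂ), Z.Finite ∧ ∀ h : StepSpace p.W p.A p.B,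
      (∀ z ∈ Z, h.1 z = 0) → ∀ z, ‖h.1 z‖ * p.succ.weight z ≤ ε * ‖h‖ := by
  have hA := p.A_pos
  have hB := p.B_pos
  obtain ⟨c, hc, hcw⟩ := exists_coneWeight_succ_le p.isConicNhd.1 hA hB
  obtain ⟨R, hR⟩ : ∃ R : ℝ, Real.exp (-c * R) ≤ ε := by
    refine ⟨-c⁻¹ * Real.log ε, ?_⟩
    rw [neg_mul, neg_mul, mul_neg, neg_neg, ← mul_assoc, mul_inv_cancel₀ hc.ne', one_mul, Real.exp_log hε]
  set M := Real.exp (2 * p.B * (R + 1)) with hM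
  set N := Real.exp ((p.A + 1)⁻¹ * R) with hN
  set δ := min 1 (ε / (M * N)) with hδ
  have hM0 : 0 < M := Real.exp_pos _
  have hN0 : 0 < N := Real.exp_pos _
  have hδ0 : 0 < δ := lt_min one_pos (by positivity)
  -- `Z` is a `δ`-net of the ball of radius `R`. Inside, the Schwarz lemma around a net point where
  -- `h` vanishes gives `|h| ≤ M‖h‖δ`, and `N` bounds the larger step's weight; outside, the weight
  -- gain is at most `ε`.
  obtain ⟨Z, hZR, hZ, hcover⟩ :=
    (isCompact_closedBall (0 : Fin k → ℂ) R).finite_cover_balls hδ0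
  refine ⟨Z, hZ, fun h hz0 z => ?_⟩
  have hw0 := (p.succ.weight_pos z).le
  rcases le_or_gt ‖z‖ R with hzR | hzR
  · obtain ⟨z₀, hz₀, hzz⟩ : ∃ z₀ ∈ Z, z ∈ ball z₀ δ := by
      simpa using hcover (mem_closedBall_zero_iff.2 hzR)
    have hz₀R : ‖z₀‖ ≤ R := mem_closedBall_zero_iff.1 (hZR hz₀)
    have hmaps : MapsTo h.1 (ball z₀ 1) (closedBall (h.1 z₀) (M * ‖h‖)) := by
      intro y hy
      rw [hz0 z₀ hz₀, mem_closedBall_zero_iff]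
      refine (h.norm_apply_le y).trans ?_
      gcongr
      refine (inv_coneWeight_le p.isConicNhd.1 hA hB y).trans ?_
      rw [hM]
      gcongr
      have := norm_le_norm_add_norm_sub' y z₀
      rw [mem_ball_iff_norm] at hy
      linarith
    have hdist : dist z z₀ ≤ δ := (mem_ball.1 hzz).le
    have h1 := Complex.dist_le_div_mul_dist_of_mapsTo_ball h.2.1.differentiableOn hmaps
      (ball_subset_ball (min_le_left _ _) hzz)
    rw [hz0 z₀ hz₀, dist_zero_right, div_one] at h1
    have h2 : p.succ.weight z ≤ N := by
      refine (coneWeight_le p.isConicNhd.1 p.succ.A_pos p.succ.B_pos z).trans ?_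
      refine Real.exp_le_exp.2 ?_
      change (p.A + 1)⁻¹ * ‖z‖ ≤ (p.A + 1)⁻¹ * R
      gcongr
    calc ‖h.1 z‖ * p.succ.weight z ≤ (M * ‖h‖ * (ε / (M * N))) * N := by
          gcongr
          exact h1.trans (by gcongr; exact hdist.trans (min_le_right _ _))
      _ = ε * ‖h‖ := by field_simp
  · calc ‖h.1 z‖ * p.succ.weight z ≤ ‖h.1 z‖ * (Real.exp (-c * ‖z‖) * p.weight z) := by
          gcongr
          exact hcw z
      _ = Real.exp (-c * ‖z‖) * (‖h.1 z‖ * p.weight z) := by ring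
      _ ≤ ε * ‖h‖ := by
          have h1 := h.norm_apply_mul_le z
          have h2 : Real.exp (-c * ‖z‖) ≤ ε := by
            refine le_trans (Real.exp_le_exp.2 ?_) hR
            nlinarith
          exact mul_le_mul h2 h1 (mul_nonneg (norm_nonneg _) (p.weight_pos z).le) hε.le

/-- A functional which is small on the common kernel of finitely many functionals is approximated by
their combinations. -/
theorem exists_mem_span_norm_sub_le {E ι : Type*} [SeminormedAddCommGroup E] [NormedSpace ℂ E]
    [Finite ι] (L : ι → E →ₗ[ℂ] ℂ) (u : E →ₗ[ℂ] ℂ) {ε : ℝ} (hε : 0 ≤ ε)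
    (hu : ∀ h, (∀ i, L i h = 0) → ‖u h‖ ≤ ε * ‖h‖) :
    ∃ φ ∈ Submodule.span ℂ (range L), ∀ h, ‖u h - φ h‖ ≤ ε * ‖h‖ := by
  let N : Submodule ℂ E := ⨅ i, LinearMap.ker (L i)
  have hN : ∀ h ∈ N, ‖u h‖ ≤ ε * ‖h‖ := fun h hh => hu h fun i => (Submodule.mem_iInf _).1 hh i
  -- Hahn–Banach extends the restriction of `u` to the common kernel `N` with norm at most `ε`. Then
  -- `u - g` vanishes on `N`, hence is a combination of the `L i`.
  obtain ⟨g, hg, hgn⟩ := exists_extension_norm_eq N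
    ((u.domRestrict N).mkContinuous ε fun h => hN h h.2)
  have hgε : ‖g‖ ≤ ε := hgn ▸ LinearMap.mkContinuous_norm_le _ hε _
  refine ⟨u - g.toLinearMap, mem_span_of_iInf_ker_le_ker fun h hh => ?_, fun h => ?_⟩
  · have := hg ⟨h, hh⟩
    rw [LinearMap.mem_ker, LinearMap.sub_apply, sub_eq_zero]
    exact this.symm
  · have h1 : u h - (u - g.toLinearMap) h = g h := sub_sub_cancel _ _
    rw [h1]
    exact (g.le_opNorm h).trans (by gcongr)

/-- The restriction of functionals on `S^0_1(K)` to a step. -/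
noncomputable def stepRestriction {K : ClosedCone k} (p : StepIndex K.carrier) :
    StrongDual ℂ (TestSpace K) →ₗ[ℂ] StepSpace p.W p.A p.B →ₗ[ℂ] ℂ where
  toFun u := u.toLinearMap ∘ₗ stepInclusion K p
  map_add' _ _ := rfl
  map_smul' _ _ := rfl

theorem stepRestriction_apply {K : ClosedCone k} (p : StepIndex K.carrier)
    (u : StrongDual ℂ (TestSpace K)) (h : StepSpace p.W p.A p.B) :
    stepRestriction p u h = u (stepInclusion K p h) := rfl

theorem exists_norm_stepRestriction_le {K : ClosedCone k} (p : StepIndex K.carrier)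
    (u : StrongDual ℂ (TestSpace K)) : ∃ D > 0, ∀ h, ‖stepRestriction p u h‖ ≤ D * ‖h‖ := by
  have hc : Continuous (stepRestriction p u) :=
    u.continuous.comp ((lcFinalTopology_mem (stepInclusion K)).2.2.2 p)
  exact (⟨stepRestriction p u, hc⟩ : StepSpace p.W p.A p.B →L[ℂ] ℂ).isBoundedLinearMap.bound

theorem StepSpace.mk_coe {U : Set (Fin k → ℝ)} {A B : ℝ} (f : (Fin k → ℂ) → ℂ)
    (hf : f ∈ stepSubmodule U A B) : (StepSpace.mk f hf).1 = f := rfl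

theorem stepInclusion_coe {K : ClosedCone k} (p : StepIndex K.carrier)
    (h : StepSpace p.W p.A p.B) : (stepInclusion K p h).1 = h.1 := rfl

theorem stepInclusion_succ {K : ClosedCone k} (p : StepIndex K.carrier)
    (h : StepSpace p.W p.A p.B) (hmem : h.1 ∈ stepSubmodule p.succ.W p.succ.A p.succ.B) :
    stepInclusion K p h = stepInclusion K p.succ (StepSpace.mk h.1 hmem) :=
  Subtype.ext <| (stepInclusion_coe p h).trans <|
    (StepSpace.mk_coe h.1 hmem).symm.trans (stepInclusion_coe p.succ (.mk h.1 hmem)).symm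

theorem norm_mk_succ_le {K : ClosedCone k} (p : StepIndex K.carrier)
    (h : StepSpace p.W p.A p.B) {C : ℝ} (hC : ∀ z, ‖h.1 z‖ * p.succ.weight z ≤ C) :
    ∃ hmem : h.1 ∈ stepSubmodule p.succ.W p.succ.A p.succ.B, ‖StepSpace.mk h.1 hmem‖ ≤ C := by
  have hmem : h.1 ∈ stepSubmodule p.succ.W p.succ.A p.succ.B := by
    refine ⟨h.2.1, C, ?_⟩
    rintro _ ⟨z, rfl⟩
    exact hC z
  exact ⟨hmem, (StepSpace.mk h.1 hmem).norm_le hC⟩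

theorem exists_finite_norm_stepRestriction_le {K : ClosedCone k} (u : StrongDual ℂ (TestSpace K))
    (p : StepIndex K.carrier) {ε : ℝ} (hε : 0 < ε) :
    ∃ Z : Set (Fin k → ℂ), Z.Finite ∧ ∀ h : StepSpace p.W p.A p.B,
      (∀ z ∈ Z, h.1 z = 0) → ‖stepRestriction p u h‖ ≤ ε * ‖h‖ := by
  obtain ⟨D, hD0, hD⟩ := exists_norm_stepRestriction_le p.succ u
  obtain ⟨Z, hZ, hZh⟩ := exists_finite_norm_mul_succ_weight_le p (div_pos hε hD0)
  refine ⟨Z, hZ, fun h h0 => ?_⟩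
  obtain ⟨hmem, hle⟩ := norm_mk_succ_le p h (hZh h h0)
  have h1 := hD (.mk h.1 hmem)
  rw [stepRestriction_apply, ← stepInclusion_succ p h hmem] at h1
  rw [stepRestriction_apply]
  refine h1.trans ((mul_le_mul_of_nonneg_left hle hD0.le).trans_eq ?_)
  rw [← mul_assoc, mul_div_cancel₀ _ hD0.ne']

/-- On each step, a functional on `S^0_1(K)` is approximated in norm by combinations of evaluations
at points. -/
theorem exists_mem_span_evalDual {K : ClosedCone k} (u : StrongDual ℂ (TestSpace K))
    (p : StepIndex K.carrier) {ε : ℝ} (hε : 0 < ε) :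
    ∃ v ∈ Submodule.span ℂ (range (evalDual K)), ∀ h : StepSpace p.W p.A p.B,
      ‖(u - v) (stepInclusion K p h)‖ ≤ ε * ‖h‖ := by
  obtain ⟨Z, hZ, hZh⟩ := exists_finite_norm_stepRestriction_le u p hε
  have : Finite Z := hZ
  obtain ⟨φ, hφ, hφu⟩ := exists_mem_span_norm_sub_le
    (fun z : Z => stepRestriction p (evalDual K z)) (stepRestriction p u) hε.le
    fun h h0 => hZh h fun z hz => h0 ⟨z, hz⟩
  have hle : Submodule.span ℂ (range fun z : Z => stepRestriction p (evalDual K z)) ≤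
      (Submodule.span ℂ (range (evalDual K))).map (stepRestriction p) := by
    refine Submodule.span_le.2 ?_
    rintro _ ⟨z, rfl⟩
    exact Submodule.mem_map_of_mem (Submodule.subset_span (mem_range_self _))
  obtain ⟨v, hv, rfl⟩ := hle hφ
  refine ⟨v, hv, fun h => ?_⟩
  rw [sub_apply]
  exact hφu h

/-- Combinations of evaluations approximate `u` in the dual norm of the very step that dominates
`ℓ`, so `|ℓ u| ≤ Cε` for every `ε > 0`. -/
theorem eq_zero_of_evalDual_eq_zero {K : ClosedCone k} (ℓ : StrongDual ℂ (TestSpace K) →ₗ[ℂ] ℂ)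
    (hℓ : Continuous ℓ) (h : ∀ z, ℓ (evalDual K z) = 0) : ℓ = 0 := by
  obtain ⟨p, C, hC0, hC⟩ := exists_step_bound ℓ hℓ
  ext u
  have hspan : ∀ v ∈ Submodule.span ℂ (range (evalDual K)), ℓ v = 0 := by
    intro v hv
    have : Submodule.span ℂ (range (evalDual K)) ≤ LinearMap.ker ℓ :=
      Submodule.span_le.2 (by rintro _ ⟨z, rfl⟩; exact h z)
    exact this hv
  have hle : ∀ ε > 0, ‖ℓ u‖ ≤ C * ε := by
    intro ε hε
    obtain ⟨v, hv, hvε⟩ := exists_mem_span_evalDual u p hε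
    have := hC (u - v) ε hε hvε
    rwa [map_sub, hspan v hv, sub_zero] at this
  have hlim : Tendsto (fun ε : ℝ => C * ε) (𝓝[>] 0) (𝓝 (C * 0)) :=
    ((continuous_const_mul C).tendsto 0).mono_left nhdsWithin_le_nhds
  rw [mul_zero] at hlim
  exact norm_le_zero_iff.1 (ge_of_tendsto hlim (by
    filter_upwards [self_mem_nhdsWithin] with ε hε using hle ε hε))

end Duals

/-! ### Triviality of the topology -/

section Trivial

open Metric Set Filter Topology

variable {k : ℕ}

/-- The closed half-line directed by `v`. -/
def rayCone (v : Fin k → ℝ) (hv : v ≠ 0) : ClosedCone k where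
  carrier := (fun t : ℝ => t • v) '' Ici 0
  isCone := by
    refine ⟨⟨_, mem_image_of_mem _ self_mem_Ici⟩, ?_⟩
    rintro t ht _ ⟨s, hs, rfl⟩
    exact ⟨t * s, mul_nonneg ht.le hs, mul_smul t s v⟩
  isClosed := (isClosedEmbedding_smul_left hv).isClosedMap _ isClosed_Ici

theorem mem_rayCone (v : Fin k → ℝ) (hv : v ≠ 0) : v ∈ (rayCone v hv).carrier :=
  ⟨1, mem_Ici.2 zero_le_one, one_smul ℝ v⟩

theorem isProperCone_rayCone (v : Fin k → ℝ) (hv : v ≠ 0) : IsProperCone (rayCone v hv).carrier := by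
  obtain ⟨j, hj⟩ := Function.ne_iff.1 hv
  refine ⟨v j • LinearMap.proj j, fun x hx hx0 => ?_⟩
  rw [(rayCone v hv).isClosed.closure_eq] at hx
  obtain ⟨t, ht, rfl⟩ := hx
  have ht0 : 0 < t := lt_of_le_of_ne ht fun h => hx0 (by simp [← h])
  have hj' : v j ≠ 0 := hj
  have : 0 < t * (v j * v j) := mul_pos ht0 (mul_self_pos.2 hj')
  simp only [LinearMap.smul_apply, LinearMap.proj_apply, Pi.smul_apply, smul_eq_mul]
  linarith

/-- The points `t⁻¹(a + tv)` of the cone tend to `v` as `t → ∞`; convexity plays no role. -/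
theorem ClosedCone.mem_of_line_mem (M : ClosedCone k) {a v : Fin k → ℝ}
    (h : ∀ t : ℝ, a + t • v ∈ M.carrier) : v ∈ M.carrier := by
  have hlim : Tendsto (fun t : ℝ => t⁻¹ • (a + t • v)) atTop (𝓝 v) := by
    have h1 : Tendsto (fun t : ℝ => t⁻¹ • a + v) atTop (𝓝 ((0 : ℝ) • a + v)) :=
      (tendsto_inv_atTop_zero.smul_const a).add_const v
    rw [zero_smul, zero_add] at h1
    refine h1.congr' ?_
    filter_upwards [eventually_gt_atTop 0] with t ht
    rw [smul_add, smul_smul, inv_mul_cancel₀ ht.ne', one_smul]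
  refine M.isClosed.mem_of_tendsto hlim ?_
  filter_upwards [eventually_gt_atTop 0] with t ht
  exact M.isCone.2 _ (inv_pos.2 ht) _ (h t)

theorem rayCone_le {M : ClosedCone k} {v : Fin k → ℝ} (hv : v ≠ 0) (h : v ∈ M.carrier) :
    rayCone v hv ≤ M := by
  rintro _ ⟨t, ht, rfl⟩
  exact M.smul_mem ht h

/-- The cone `{0}`. -/
def zeroCone (k : ℕ) : ClosedCone k where
  carrier := {0}
  isCone := ⟨⟨0, rfl⟩, by rintro t _ _ rfl; exact smul_zero t⟩
  isClosed := isClosed_singleton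

theorem isProperCone_zeroCone : IsProperCone (zeroCone k).carrier :=
  ⟨0, fun x hx h0 => absurd (by simpa [zeroCone] using hx) h0⟩

theorem zeroCone_le (M : ClosedCone k) : zeroCone k ≤ M := by
  rintro _ rfl
  exact M.zero_mem

open Classical in
theorem ultraOf_dualRestriction (M : ClosedCone k) {K' K : ProperSubcone M} (h : K' ≤ K)
    (u : StrongDual ℂ (TestSpace K'.1)) :
    ultraOf M K (dualRestriction h u) = ultraOf M K' u :=
  Module.DirectLimit.of_f

open Classical in
theorem ultra_hom_ext (M : ClosedCone k) {F : Type*} [AddCommGroup F] [Module ℂ F]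
    {f g : Ultra M →ₗ[ℂ] F} (h : ∀ K, f ∘ₗ ultraOf M K = g ∘ₗ ultraOf M K) : f = g :=
  Module.DirectLimit.hom_ext h

/-- The functions `z ↦ ℓ(δ_z)` defined by a functional on `𝓤(M)` vanish when `M` contains a line. -/
theorem ultraOf_evalDual_eq_zero (M : ClosedCone k) {v : Fin k → ℝ} (hv : v ≠ 0)
    (hvM : v ∈ M.carrier) (hvM' : -v ∈ M.carrier) (ℓ : Ultra M →ₗ[ℂ] ℂ)
    (hℓ : ∀ K, Continuous (ℓ ∘ₗ ultraOf M K)) (K : ProperSubcone M) (z : Fin k → ℂ) :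
    ℓ (ultraOf M K (evalDual K.1 z)) = 0 := by
  let Z : ProperSubcone M := ⟨zeroCone k, isProperCone_zeroCone, zeroCone_le M⟩
  -- Restricting `δ_z` from `S^0_1({0})` to `S^0_1(K)` gives `δ_z` again, so its class in `𝓤(M)` is
  -- the same for all `K`.
  have hZ : ∀ (K : ProperSubcone M) (z : Fin k → ℂ),
      ℓ (ultraOf M K (evalDual K.1 z)) = ℓ (ultraOf M Z (evalDual Z.1 z)) := fun K z =>
    congrArg ℓ (ultraOf_dualRestriction M (K' := Z) (K := K) (zeroCone_le K.1) (evalDual Z.1 z))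
  let P : ProperSubcone M := ⟨rayCone v hv, isProperCone_rayCone v hv, rayCone_le hv hvM⟩
  have hv' : -v ≠ 0 := neg_ne_zero.2 hv
  let Q : ProperSubcone M := ⟨rayCone (-v) hv', isProperCone_rayCone _ hv', rayCone_le hv' hvM'⟩
  set v' : Fin k → ℂ := fun j => (v j : ℂ) with hvv
  have hneg : (fun j => ((-v) j : ℂ)) = -v' := by ext j; simp [hvv]
  -- Base point chosen so that `ζ = i` corresponds to `z`; vanishing at `i` is then enough.
  set w : Fin k → ℂ := z - Complex.I • v' with hw
  set g : ℂ → ℂ := fun ζ => ℓ (ultraOf M Z (evalDual Z.1 (w + ζ • v'))) with hg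
  have hgd : Differentiable ℂ g := differentiable_evalDual_line (ℓ ∘ₗ ultraOf M Z) (hℓ Z) w v'
  obtain ⟨p, C, hC, hp⟩ := exists_norm_evalDual_le (ℓ ∘ₗ ultraOf M P) (hℓ P)
  obtain ⟨q, D, hD, hq⟩ := exists_norm_evalDual_le (ℓ ∘ₗ ultraOf M Q) (hℓ Q)
  obtain ⟨a, ha, b, E, hb, hE, hpE⟩ := exists_inv_coneWeight_line_le p.isConicNhd.1 p.A_pos p.B_pos
    hv (p.isConicNhd.2.1 (mem_rayCone v hv)) w
  obtain ⟨a', ha', b', E', hb', hE', hqE⟩ := exists_inv_coneWeight_line_le q.isConicNhd.1 q.A_pos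
    q.B_pos hv' (q.isConicNhd.2.1 (mem_rayCone (-v) hv')) w
  have hbound : ∀ ζ : ℂ, ‖g ζ‖ ≤
      (C * E + D * E') * Real.exp (-(min a a') * |ζ.re| + max b b' * |ζ.im|) := by
    intro ζ
    rcases le_total 0 ζ.re with h | h
    · have h1 : ‖g ζ‖ ≤ C * (p.weight (w + ζ • v'))⁻¹ := by
        rw [hg]
        simp only
        rw [← hZ P]
        exact hp _
      calc ‖g ζ‖ ≤ C * (E * Real.exp (-a * |ζ.re| + b * |ζ.im|)) :=
            h1.trans (mul_le_mul_of_nonneg_left (hpE ζ h) hC)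
        _ ≤ C * (E * Real.exp (-(min a a') * |ζ.re| + max b b' * |ζ.im|)) := by
            gcongr
            · exact min_le_left _ _
            · exact le_max_left _ _
        _ = C * E * Real.exp (-(min a a') * |ζ.re| + max b b' * |ζ.im|) := by ring
        _ ≤ _ := by gcongr; exact le_add_of_nonneg_right (by positivity)
    · have h1 : ‖g ζ‖ ≤ D * (q.weight (w + ζ • v'))⁻¹ := by
        rw [hg]
        simp only
        rw [← hZ Q]
        exact hq _
      have h2 := hqE (-ζ) (by simpa using h)
      rw [hneg, smul_neg, neg_smul, neg_neg, Complex.neg_re, Complex.neg_im, abs_neg, abs_neg] at h2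
      calc ‖g ζ‖ ≤ D * (E' * Real.exp (-a' * |ζ.re| + b' * |ζ.im|)) :=
            h1.trans (mul_le_mul_of_nonneg_left h2 hD)
        _ ≤ D * (E' * Real.exp (-(min a a') * |ζ.re| + max b b' * |ζ.im|)) := by
            gcongr
            · exact min_le_right _ _
            · exact le_max_right _ _
        _ = D * E' * Real.exp (-(min a a') * |ζ.re| + max b b' * |ζ.im|) := by ring
        _ ≤ _ := by gcongr; exact le_add_of_nonneg_left (by positivity)
  have hI := eq_zero_at_I_of_norm_le_exp hgd (lt_min ha ha') hbound
  rw [hZ K z]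
  simpa [hg, hw] using hI

end Trivial

/-- If the closed cone `M` contains a straight line, then the only open sets of the inductive limit
topology on `𝓤(M)` are `∅` and `𝓤(M)`. -/
theorem lemma3p3 {k : ℕ} (M : ClosedCone k)
    (hM : ∃ a v : Fin k → ℝ, v ≠ 0 ∧ ∀ t : ℝ, a + t • v ∈ M.carrier) :
    ∀ O : Set (Ultra M), @IsOpen (Ultra M) (ultraTopology M) O ↔ O = ∅ ∨ O = Set.univ := by
  obtain ⟨a, v, hv, hline⟩ := hM
  have hvM := M.mem_of_line_mem hline
  have hvM' : -v ∈ M.carrier := M.mem_of_line_mem (a := a) fun t => by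
    simpa using hline (-t)
  let _ : TopologicalSpace (Ultra M) := ultraTopology M
  obtain ⟨h1, h2, h3, h4⟩ := lcFinalTopology_mem (ultraOf M)
  have := IsScalarTower.continuousSMul (M := ℝ) (α := Ultra M) ℂ
  have hzero : ∀ ℓ : StrongDual ℂ (Ultra M), ∀ x, ℓ x = 0 := by
    intro ℓ x
    have hcont : ∀ K, Continuous (ℓ.toLinearMap ∘ₗ ultraOf M K) := fun K =>
      ℓ.continuous.comp (h4 K)
    have : ℓ.toLinearMap = 0 := ultra_hom_ext M fun K =>
      eq_zero_of_evalDual_eq_zero _ (hcont K) fun z =>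
        ultraOf_evalDual_eq_zero M hv hvM hvM' ℓ.toLinearMap hcont K z
    exact LinearMap.congr_fun this x
  intro O
  refine ⟨fun hO => ?_, ?_⟩
  · rcases O.eq_empty_or_nonempty with h | ⟨x, hx⟩
    · exact Or.inl h
    · refine Or.inr (Set.eq_univ_of_forall fun y => ?_)
      obtain ⟨V, ⟨hxV, hVc⟩, hVO⟩ :=
        (LocallyConvexSpace.convex_basis (𝕜 := ℝ) x).mem_iff.1 (hO.mem_nhds hx)
      refine hVO (interior_subset (by_contra fun hy => ?_))
      -- A point `y` outside the open convex set `interior V` would be separated from `x` by a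
      -- continuous functional, but all of these are zero.
      obtain ⟨f, hf⟩ :=
        RCLike.geometric_hahn_banach_open_point (𝕜 := ℂ) hVc.interior isOpen_interior hy
      have := hf x (mem_interior_iff_mem_nhds.2 hxV)
      rw [hzero, hzero] at this
      exact lt_irrefl _ this
  · rintro (rfl | rfl)
    · exact isOpen_empty
    · exact isOpen_univ
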